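/- Let $L \ge 1$ and $S \ge 0$ be integers with $L+S \ge 2$, and let $\gamma$ be the positive root of $L\gamma + S\gamma^2 = 1$. For a nonnegative integer $n$ let $a_k(n) \in \{0,\dots,L+S-1\}$ be its digits in base $L+S$, so that $n = \sum_{k \ge 0} a_k(n)(L+S)^k$. Let $\mathbb{N}_{L,S}$ be the set of all $n \ge 0$ such that for no $k \ge 0$ one has both $a_k(n) \ge L$ and $a_{k+1}(n) \ge 1$. For $n \in \mathbb{N}_{L,S}$ put $$\phi_{L,S}(n) = \sum_{k \ge 0} \tilde a_k(n)\,\gamma^{k+1}, \qquad \tilde a_k(n) = \begin{cases} a_k(n) & \text{if } a_k(n) \le L-1,\\ L + \gamma\,(a_k(n) - L) & \text{if } a_k(n) \ge L,\end{cases}$$ and let $\xi^1_{L,S}, \xi^2_{L,S}, \dots$ be the values of $\phi_{L,S}$ at the elements of $\mathbb{N}_{L,S}$ taken in increasing order (so $\xi^1_{L,S} = \phi_{L,S}(0) = 0$). For $N \ge 1$ let $$P_{L,S}(N) = \Big\{ \Big( \tfrac{n-1}{N},\, \xi^n_{L,S} \Big) : n = 1, \dots, N \Big\}.$$ The discrepancy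 of a finite nonempty set $P$ of points in the unit square is $$D(P) = \sup_{\substack{0 \le a_1 < b_1 \le 1\\ 0 \le a_2 < b_2 \le 1}} \left| \frac{\#\big(P \cap [a_1,b_1[ \times [a_2,b_2[\big)}{\# P} - (b_1-a_1)(b_2-a_2) \right| .$$ Then the following hold. 1. If $S \le L$, there is a constant $C_1 > 0$ such that $N\,D(P_{L,S}(N)) \le C_1 \log N$ for all integers $N \ge 2$. 2. If $S = L+1$, there is a constant $C_2 > 0$ such that $N\,D(P_{L,S}(N)) \le C_2 \log^2 N$ for all integers $N \ge 2$. 3. If $S \ge L+2$ and $\tau$ is defined by $1 - \tau = -\dfrac{\log(S\gamma)}{\log\gamma}$, then $1 - \tau > 0$ and there is a constant $C_3 > 0$ such that $N\,D(P_{L,S}(N)) \le C_3\, N^{1-\tau} \log N$ for all integers $N \ge 2$. The constants $C_1, C_2, C_3$ depend only on $L$ and $S$. -/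

import Mathlib

/-- The digit `a_k(n)` of `n` in base `L + S`. -/
def lsDigit (L S n k : ℕ) : ℕ := n / (L + S) ^ k % (L + S)

/-- Membership in `ℕ_{L,S}`: no digit `≥ L` is followed, in the next higher place,
by a nonzero digit (digits lie in `{0, …, L + S - 1}`). -/
def LSAdmissible (L S n : ℕ) : Prop :=
  ∀ k : ℕ, ¬ (L ≤ lsDigit L S n k ∧ 1 ≤ lsDigit L S n (k + 1))

/-- The modified digit: `a` if `a ≤ L - 1`, and `L + γ (a - L)` if `a ≥ L`. -/
noncomputable def lsModDigit (L : ℕ) (γ : ℝ) (a : ℕ) : ℝ :=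
  if a < L then (a : ℝ) else (L : ℝ) + γ * ((a : ℝ) - (L : ℝ))

/-- `φ_{L,S}(n) = ∑_{k=0}^{M} ã_k(n) γ^{k+1}`, with `M = ⌊log_{L+S} n⌋`
(and `M = 0` for `n = 0`). -/
noncomputable def lsPhi (L S : ℕ) (γ : ℝ) (n : ℕ) : ℝ :=
  ∑ k ∈ Finset.range (Nat.log (L + S) n + 1), lsModDigit L γ (lsDigit L S n k) * γ ^ (k + 1)

/-- The `LS`-sequence of points `ξ¹, ξ², …`: the values of `φ_{L,S}` along the admissible numbers
in increasing order, starting with `ξ¹ = φ_{L,S}(0)`. (`Nat.nth` counts from `0`; the index `n` is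
meant to be at least `1`.) -/
noncomputable def lsPoint (L S : ℕ) (γ : ℝ) (n : ℕ) : ℝ :=
  lsPhi L S γ (Nat.nth (LSAdmissible L S) (n - 1))

open Classical in
/-- The `LS`-point set à la van der Corput of order `N`:
the points `((n - 1) / N, ξⁿ)` for `n = 1, …, N`. -/
noncomputable def lsPointSet (L S : ℕ) (γ : ℝ) (N : ℕ) : Finset (ℝ × ℝ) :=
  (Finset.Icc 1 N).image fun n : ℕ => (((n : ℝ) - 1) / (N : ℝ), lsPoint L S γ n)

open Classical in
/-- The discrepancy of a finite nonempty set of points in the unit square: the supremum, over all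
half-open rectangles `[a₁, b₁) × [a₂, b₂)` in the unit square, of the absolute difference between
the proportion of points in the rectangle and its area. -/
noncomputable def squareDiscrepancy (P : Finset (ℝ × ℝ)) : ℝ :=
  sSup {d : ℝ | ∃ a₁ b₁ a₂ b₂ : ℝ, 0 ≤ a₁ ∧ a₁ < b₁ ∧ b₁ ≤ 1 ∧ 0 ≤ a₂ ∧ a₂ < b₂ ∧ b₂ ≤ 1 ∧
    d = |((P.filter fun p => p ∈ Set.Ico a₁ b₁ ×ˢ Set.Ico a₂ b₂).card : ℝ) / (P.card : ℝ)
          - (b₁ - a₁) * (b₂ - a₂)|}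

/-!
The admissible numbers with lowest digit `d` are those of the form `lsPrepend L S d m` with `m`
admissible, and on points `m ↦ lsPrepend L S d m` is the affine map of `[0, 1)` onto the `d`-th
interval of the first partition, which has length `γ` for `d < L` and `γ²` for `L ≤ d`
(`lsPhi_lsPrepend`). So the points are self-similar, and both the number `A(X)` of admissible
numbers below `X` and the number of those whose point lies below `y` split as sums over `d`
(`lsCount_eq_sum`, `lsCountBelow_eq_sum`).

For `A` alone, with `B = L + S`, this gives `A(X) = L A(X/B) + S A(X/B²) + O(1)`. Since
`L γ + S γ² = 1`, the deviation `R(X) = A(X/B) - γ A(X)` satisfies `R(X) = -S γ R(X/B) + O(1)`, so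
`R(X) = O(1 + S γ + ⋯ + (S γ) ^ K)` for `X ≤ B ^ K` (`abs_lsCount_div_sub_le`). The local
discrepancy at `y` of the points of the admissible numbers below `X` is the local discrepancy, at a
rescaled `y`, of the part that falls into the one interval of the first partition containing `y`,
plus boundedly many deviations of this kind. Iterating over `K` levels yields the bound
`O((K + 1) (1 + S γ + ⋯ + (S γ) ^ K))` (`abs_lsCountBelow_sub_le`).

As `A(B ^ K) ≥ γ ^ (-K)` (`one_le_pow_mul_lsCount`), the first `N` points are covered by
`K = log N / log (1 / γ) + O(1)`. A rectangle with one side on the index axis is a combination of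
four initial segments of the sequence, which transfers the bound to the planar point set
(`mul_squareDiscrepancy_le`). Finally `S γ` is less than, equal to or greater than `1` according to
whether `S ≤ L`, `S = L + 1` or `S ≥ L + 2`, so that the geometric sum is bounded, of order
`log N`, or of order `(S γ) ^ K = O(N ^ (1 - τ))`.
-/

/-! ### Splitting numbers by their lowest digit -/

/-- The number of `m` with `d + B * m < X`, for a residue `d < B`. -/
def residueCount (B X d : ℕ) : ℕ := X / B + if d < X % B then 1 else 0

theorem residueCount_succ {B d : ℕ} (hd : d < B) (X : ℕ) :
    residueCount B (X + 1) d = residueCount B X d + if d = X % B then 1 else 0 := by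
  have hB : 0 < B := by omega
  have hr : X % B < B := Nat.mod_lt _ hB
  have hX : B * (X / B) + X % B = X := Nat.div_add_mod X B
  unfold residueCount
  generalize X % B = r at *
  generalize X / B = q at *
  subst hX
  rcases Nat.lt_or_ge (r + 1) B with h | h
  · have h1 : (B * q + r + 1) / B = q := by
      rw [add_assoc, Nat.mul_add_div hB, Nat.div_eq_of_lt h, add_zero]
    have h2 : (B * q + r + 1) % B = r + 1 := by
      rw [add_assoc, Nat.mul_add_mod, Nat.mod_eq_of_lt h]
    rw [h1, h2]
    split_ifs <;> omega
  · have h3 : B * q + r + 1 = B * (q + 1) := by rw [mul_add]; omega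
    rw [h3, Nat.mul_div_cancel_left _ hB, Nat.mul_mod_right]
    split_ifs <;> omega

theorem residueCount_le {B X Y d : ℕ} (h : X ≤ B * Y) :
    residueCount B X d ≤ Y := by
  unfold residueCount
  have hX : B * (X / B) + X % B = X := Nat.div_add_mod X B
  have h1 : X / B ≤ Y := Nat.div_le_of_le_mul h
  rcases h1.lt_or_eq with h1 | h1
  · split_ifs <;> omega
  · rw [h1] at hX
    rw [if_neg (by omega)]
    omega

theorem count_eq_sum_residues {B : ℕ} (hB : 0 < B) (p : ℕ → Prop) [DecidablePred p] (X : ℕ) :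
    Nat.count p X =
      ∑ d ∈ Finset.range B, Nat.count (fun m => p (d + B * m)) (residueCount B X d) := by
  induction X with
  | zero => simp [residueCount]
  | succ X ih =>
    have hr : X % B < B := Nat.mod_lt _ hB
    have key : ∀ d ∈ Finset.range B,
        Nat.count (fun m => p (d + B * m)) (residueCount B (X + 1) d) =
          Nat.count (fun m => p (d + B * m)) (residueCount B X d) +
            if d = X % B then (if p X then 1 else 0) else 0 := by
      intro d hd
      rw [residueCount_succ (Finset.mem_range.1 hd)]
      by_cases h : d = X % B
      · have h0 : residueCount B X d = X / B := by simp [residueCount, h]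
        have h1 : d + B * (X / B) = X := by rw [h]; exact Nat.mod_add_div X B
        rw [if_pos h, if_pos h, Nat.count_succ, h0, h1]
      · simp [h]
    rw [Finset.sum_congr rfl key, Finset.sum_add_distrib, ← ih, Finset.sum_ite_eq',
      if_pos (Finset.mem_range.2 hr), Nat.count_succ]

/-! ### Digits, admissibility and the map `φ` under prepending a digit -/

theorem lsDigit_zero (L S n : ℕ) : lsDigit L S n 0 = n % (L + S) := by simp [lsDigit]

theorem lsDigit_add_mul_zero {L S d : ℕ} (hd : d < L + S) (m : ℕ) :
    lsDigit L S (d + (L + S) * m) 0 = d := by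
  simp [lsDigit, Nat.mod_eq_of_lt hd]

theorem lsDigit_add_mul_succ {L S d : ℕ} (hd : d < L + S) (m k : ℕ) :
    lsDigit L S (d + (L + S) * m) (k + 1) = lsDigit L S m k := by
  have h : (d + (L + S) * m) / (L + S) = m := by
    rw [Nat.add_mul_div_left _ _ (by omega), Nat.div_eq_of_lt hd, zero_add]
  rw [lsDigit, pow_succ', ← Nat.div_div_eq_div_mul, h, lsDigit]

theorem lsAdmissible_add_mul {L S d : ℕ} (hd : d < L + S) (m : ℕ) :
    LSAdmissible L S (d + (L + S) * m) ↔
      LSAdmissible L S m ∧ (L ≤ d → m % (L + S) = 0) := by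
  constructor
  · intro h
    refine ⟨fun k => ?_, fun hLd => ?_⟩
    · have := h (k + 1)
      rwa [lsDigit_add_mul_succ hd, lsDigit_add_mul_succ hd] at this
    · have := h 0
      rw [lsDigit_add_mul_zero hd, lsDigit_add_mul_succ hd, lsDigit_zero] at this
      by_contra h0
      exact this ⟨hLd, Nat.one_le_iff_ne_zero.2 h0⟩
  · rintro ⟨h1, h2⟩ k
    cases k with
    | zero =>
      rw [lsDigit_add_mul_zero hd, lsDigit_add_mul_succ hd, lsDigit_zero]
      rintro ⟨h3, h4⟩
      have := h2 h3
      omega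
    | succ k =>
      rw [lsDigit_add_mul_succ hd, lsDigit_add_mul_succ hd]
      exact h1 k

theorem lsAdmissible_mul {L S : ℕ} (hL : 1 ≤ L) (m : ℕ) :
    LSAdmissible L S ((L + S) * m) ↔ LSAdmissible L S m := by
  have := lsAdmissible_add_mul (L := L) (S := S) (d := 0) (by omega) m
  rw [zero_add] at this
  rw [this]
  exact and_iff_left fun h => by omega

theorem lsAdmissible_zero (L S : ℕ) : LSAdmissible L S 0 := by
  intro k
  simp [lsDigit]

/-- The sum defining `φ_{L,S}` may be taken over any range that covers the nonzero digits. -/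
theorem lsPhi_eq_sum {L S : ℕ} (hL : 1 ≤ L) (hLS : 2 ≤ L + S) (γ : ℝ) {n K : ℕ}
    (hn : n < (L + S) ^ K) :
    lsPhi L S γ n =
      ∑ k ∈ Finset.range K, lsModDigit L γ (lsDigit L S n k) * γ ^ (k + 1) := by
  have hvanish : ∀ k, n < (L + S) ^ k →
      lsModDigit L γ (lsDigit L S n k) * γ ^ (k + 1) = 0 := by
    intro k hk
    have hd : lsDigit L S n k = 0 := by simp [lsDigit, Nat.div_eq_of_lt hk]
    simp [hd, lsModDigit, Nat.lt_of_lt_of_le Nat.zero_lt_one hL]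
  have hext : ∀ {a b : ℕ}, a ≤ b → n < (L + S) ^ a →
      ∑ k ∈ Finset.range a, lsModDigit L γ (lsDigit L S n k) * γ ^ (k + 1) =
        ∑ k ∈ Finset.range b, lsModDigit L γ (lsDigit L S n k) * γ ^ (k + 1) := by
    intro a b hab ha
    refine Finset.sum_subset (by simpa using hab) fun k _ hk => hvanish k ?_
    exact ha.trans_le (Nat.pow_le_pow_right (by omega) (by simpa using hk))
  have hlog : n < (L + S) ^ (Nat.log (L + S) n + 1) := Nat.lt_pow_succ_log_self (by omega) n
  rw [lsPhi]
  rcases le_total K (Nat.log (L + S) n + 1) with h | h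
  · exact (hext h hn).symm
  · exact hext h hlog

theorem lsPhi_add_mul {L S : ℕ} (hL : 1 ≤ L) (hLS : 2 ≤ L + S) (γ : ℝ) {d : ℕ}
    (hd : d < L + S) (m : ℕ) :
    lsPhi L S γ (d + (L + S) * m) = γ * lsModDigit L γ d + γ * lsPhi L S γ m := by
  have hm : m < (L + S) ^ m := Nat.lt_pow_self (by omega)
  have hn : d + (L + S) * m < (L + S) ^ (m + 1) := by
    have : (L + S) * (m + 1) ≤ (L + S) * (L + S) ^ m := Nat.mul_le_mul_left _ hm
    rw [pow_succ']
    rw [mul_add] at this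
    omega
  rw [lsPhi_eq_sum hL hLS γ hn, lsPhi_eq_sum hL hLS γ hm, Finset.sum_range_succ',
    Finset.mul_sum, add_comm]
  congr 1
  · rw [lsDigit_add_mul_zero hd]; ring
  · refine Finset.sum_congr rfl fun k _ => ?_
    rw [lsDigit_add_mul_succ hd]; ring

/-- The number obtained from `m` by prepending the lowest digit `d`; a digit `d ≥ L` is prepended
together with the `0` that has to follow it. -/
def lsPrepend (L S d m : ℕ) : ℕ :=
  if d < L then d + (L + S) * m else d + (L + S) * ((L + S) * m)

/-- The number of `m` with `lsPrepend L S d m < X`, for a digit `d < L + S`. -/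
def lsTail (L S X d : ℕ) : ℕ :=
  if d < L then residueCount (L + S) X d else residueCount (L + S) (residueCount (L + S) X d) 0

open scoped Classical in
/-- Sorting the admissible numbers below `X` by their lowest digit. -/
theorem count_lsAdmissible_and {L S : ℕ} (hL : 1 ≤ L) (Q : ℕ → Prop) (X : ℕ) :
    Nat.count (fun n => LSAdmissible L S n ∧ Q n) X =
      ∑ d ∈ Finset.range (L + S),
        Nat.count (fun m => LSAdmissible L S m ∧ Q (lsPrepend L S d m)) (lsTail L S X d) := by
  rw [count_eq_sum_residues (B := L + S) (by omega)]
  refine Finset.sum_congr rfl fun d hd => ?_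
  rw [Finset.mem_range] at hd
  unfold lsTail lsPrepend
  by_cases h : d < L
  · simp only [if_pos h]
    congr 1
    funext m
    rw [lsAdmissible_add_mul hd, and_iff_left (fun h' => absurd h (not_lt.2 h'))]
  · simp only [if_neg h]
    rw [count_eq_sum_residues (B := L + S) (by omega), Finset.sum_eq_single 0]
    · congr 1
      funext m
      rw [lsAdmissible_add_mul hd, zero_add, lsAdmissible_mul hL,
        and_iff_left (fun _ => Nat.mul_mod_right _ _)]
    · intro e he he0
      rw [Finset.mem_range] at he
      rw [Nat.count_iff_forall_not]
      rintro m - ⟨hm, -⟩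
      have h0 := ((lsAdmissible_add_mul hd _).1 hm).2 (not_lt.1 h)
      rw [Nat.add_mul_mod_self_left, Nat.mod_eq_of_lt he] at h0
      exact he0 h0
    · intro h0
      exact absurd (Finset.mem_range.2 (by omega)) h0

/-! ### The first partition of the unit interval -/

/-- The left endpoint of the `d`-th interval of the first partition of `[0, 1)`. -/
noncomputable def lsCut (L : ℕ) (γ : ℝ) (d : ℕ) : ℝ := γ * lsModDigit L γ d

/-- The length of the `d`-th interval of the first partition of `[0, 1)`: `L` long intervals are
followed by `S` short ones. -/
noncomputable def lsWidth (L : ℕ) (γ : ℝ) (d : ℕ) : ℝ := if d < L then γ else γ ^ 2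

theorem lsCut_zero {L : ℕ} (hL : 1 ≤ L) (γ : ℝ) : lsCut L γ 0 = 0 := by
  simp [lsCut, lsModDigit, Nat.lt_of_lt_of_le Nat.zero_lt_one hL]

theorem lsCut_succ (L : ℕ) (γ : ℝ) (d : ℕ) : lsCut L γ (d + 1) = lsCut L γ d + lsWidth L γ d := by
  unfold lsCut lsWidth lsModDigit
  rcases lt_trichotomy (d + 1) L with h | h | h
  · rw [if_pos h, if_pos (by omega), if_pos (by omega)]; push_cast; ring
  · rw [if_neg (by omega), if_pos (by omega), if_pos (by omega), ← h]; push_cast; ring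
  · rw [if_neg (by omega), if_neg (by omega), if_neg (by omega)]; push_cast; ring

theorem lsCut_last {L S : ℕ} {γ : ℝ} (hγ : (L : ℝ) * γ + (S : ℝ) * γ ^ 2 = 1) :
    lsCut L γ (L + S) = 1 := by
  rw [← hγ, lsCut, lsModDigit, if_neg (by omega)]; push_cast; ring

theorem lsWidth_pos (L : ℕ) {γ : ℝ} (h : 0 < γ) (d : ℕ) : 0 < lsWidth L γ d := by
  unfold lsWidth; split_ifs <;> positivity

theorem lsCut_mono (L : ℕ) {γ : ℝ} (h : 0 < γ) : Monotone (lsCut L γ) :=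
  monotone_nat_of_le_succ fun d => by
    rw [lsCut_succ]; exact le_add_of_nonneg_right (lsWidth_pos L h d).le

theorem ls_gamma_lt_one {L S : ℕ} (hL : 1 ≤ L) (hLS : 2 ≤ L + S) {γ : ℝ}
    (hγ : (L : ℝ) * γ + (S : ℝ) * γ ^ 2 = 1) : γ < 1 := by
  by_contra! h
  have h1 : (1 : ℝ) ≤ L := by exact_mod_cast hL
  have h2 : (2 : ℝ) ≤ L + S := by exact_mod_cast hLS
  have h3 : (0 : ℝ) ≤ S := Nat.cast_nonneg S
  have h4 : (L : ℝ) * 1 ≤ L * γ := by gcongr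
  have h5 : (S : ℝ) * 1 ≤ S * γ ^ 2 := by gcongr; exact one_le_pow₀ h
  linarith

theorem lsPhi_zero {L S : ℕ} (hL : 1 ≤ L) (hLS : 2 ≤ L + S) (γ : ℝ) : lsPhi L S γ 0 = 0 := by
  rw [lsPhi_eq_sum hL hLS γ (n := 0) (K := 0) (by simp)]; simp

/-- Prepending the digit `d` maps `[0, 1)` affinely onto the `d`-th interval of the first
partition. -/
theorem lsPhi_lsPrepend {L S : ℕ} (hL : 1 ≤ L) (hLS : 2 ≤ L + S) (γ : ℝ) {d : ℕ}
    (hd : d < L + S) (m : ℕ) :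
    lsPhi L S γ (lsPrepend L S d m) = lsCut L γ d + lsWidth L γ d * lsPhi L S γ m := by
  unfold lsPrepend lsCut lsWidth
  split_ifs
  · exact lsPhi_add_mul hL hLS γ hd m
  · have h0 := lsPhi_add_mul hL hLS γ (show 0 < L + S by omega) m
    have hz : lsModDigit L γ 0 = 0 := by
      simp [lsModDigit, Nat.lt_of_lt_of_le Nat.zero_lt_one hL]
    rw [zero_add, hz, mul_zero, zero_add] at h0
    rw [lsPhi_add_mul hL hLS γ hd, h0]
    ring

theorem exists_eq_lsPrepend {L S : ℕ} (hL : 1 ≤ L) {n : ℕ}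
    (hn : LSAdmissible L S n) :
    ∃ d < L + S, ∃ m, LSAdmissible L S m ∧ n = lsPrepend L S d m := by
  have hB : 0 < L + S := by omega
  have hd : n % (L + S) < L + S := Nat.mod_lt _ hB
  have heq : n % (L + S) + (L + S) * (n / (L + S)) = n := Nat.mod_add_div n _
  have hadm := hn
  rw [← heq, lsAdmissible_add_mul hd] at hadm
  refine ⟨n % (L + S), hd, ?_⟩
  by_cases h : n % (L + S) < L
  · exact ⟨n / (L + S), hadm.1, by rw [lsPrepend, if_pos h, heq]⟩
  · have h0 : (L + S) * (n / (L + S) / (L + S)) = n / (L + S) :=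
      Nat.mul_div_cancel' (Nat.dvd_of_mod_eq_zero (hadm.2 (not_lt.1 h)))
    refine ⟨n / (L + S) / (L + S), ?_, by rw [lsPrepend, if_neg h, h0, heq]⟩
    rw [← lsAdmissible_mul hL, h0]
    exact hadm.1

theorem lt_lsPrepend {L S : ℕ} (hLS : 2 ≤ L + S) {d m : ℕ} (h : lsPrepend L S d m ≠ 0) :
    m < lsPrepend L S d m := by
  rcases Nat.eq_zero_or_pos m with rfl | hm
  · omega
  · have h1 : 2 * m ≤ (L + S) * m := Nat.mul_le_mul_right _ hLS
    have h2 : 2 * ((L + S) * m) ≤ (L + S) * ((L + S) * m) := Nat.mul_le_mul_right _ hLS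
    unfold lsPrepend
    split_ifs <;> omega

theorem lsPhi_mem_Ico {L S : ℕ} (hL : 1 ≤ L) (hLS : 2 ≤ L + S) {γ : ℝ} (hγ0 : 0 < γ)
    (hγ : (L : ℝ) * γ + (S : ℝ) * γ ^ 2 = 1) (n : ℕ) (hn : LSAdmissible L S n) :
    lsPhi L S γ n ∈ Set.Ico (0 : ℝ) 1 := by
  induction n using Nat.strong_induction_on with
  | _ n ih =>
    rcases eq_or_ne n 0 with rfl | h0
    · rw [lsPhi_zero hL hLS]; simp
    · obtain ⟨d, hd, m, hm, rfl⟩ := exists_eq_lsPrepend hL hn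
      obtain ⟨h1, h2⟩ := ih m (lt_lsPrepend hLS h0) hm
      rw [lsPhi_lsPrepend hL hLS γ hd]
      have hw := lsWidth_pos L hγ0 d
      have hx : 0 ≤ lsCut L γ d := by
        rw [← lsCut_zero hL γ]; exact lsCut_mono L hγ0 (Nat.zero_le d)
      have hx1 : lsCut L γ d + lsWidth L γ d ≤ 1 := by
        rw [← lsCut_succ, ← lsCut_last hγ]; exact lsCut_mono L hγ0 hd
      constructor
      · positivity
      · nlinarith

/-! ### Counting admissible numbers -/

/-- The number of admissible numbers below `X`. -/
noncomputable def lsCount (L S X : ℕ) : ℕ :=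
  open scoped Classical in Nat.count (LSAdmissible L S) X

/-- The number of admissible numbers below `X` whose point lies in `[0, y)`. -/
noncomputable def lsCountBelow (L S : ℕ) (γ y : ℝ) (X : ℕ) : ℕ :=
  open scoped Classical in Nat.count (fun n => LSAdmissible L S n ∧ lsPhi L S γ n < y) X

section Counting

variable {L S : ℕ} {γ : ℝ}

theorem lsCount_mono : Monotone (lsCount L S) := fun a b h => by
  classical exact Nat.count_monotone _ h

theorem lsCount_succ_le (X : ℕ) : lsCount L S (X + 1) ≤ lsCount L S X + 1 := by
  unfold lsCount
  rw [Nat.count_succ]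
  split_ifs <;> omega

theorem lsCountBelow_of_one_le (hL : 1 ≤ L) (hLS : 2 ≤ L + S) (hγ0 : 0 < γ)
    (hγ : (L : ℝ) * γ + (S : ℝ) * γ ^ 2 = 1) {y : ℝ} (hy : 1 ≤ y) (X : ℕ) :
    lsCountBelow L S γ y X = lsCount L S X := by
  unfold lsCountBelow lsCount
  congr 1
  funext n
  exact propext (and_iff_left_of_imp fun h =>
    (lsPhi_mem_Ico hL hLS hγ0 hγ n h).2.trans_le hy)

theorem lsCountBelow_of_nonpos (hL : 1 ≤ L) (hLS : 2 ≤ L + S) (hγ0 : 0 < γ)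
    (hγ : (L : ℝ) * γ + (S : ℝ) * γ ^ 2 = 1) {y : ℝ} (hy : y ≤ 0) (X : ℕ) :
    lsCountBelow L S γ y X = 0 := by
  classical
  unfold lsCountBelow
  refine Nat.count_of_forall_not ?_
  rintro n - ⟨h, h'⟩
  exact absurd ((lsPhi_mem_Ico hL hLS hγ0 hγ n h).1.trans_lt h') (not_lt.2 hy)

theorem lsCountBelow_eq_sum (hL : 1 ≤ L) (hLS : 2 ≤ L + S) (hγ0 : 0 < γ) (y : ℝ) (X : ℕ) :
    lsCountBelow L S γ y X = ∑ d ∈ Finset.range (L + S),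
      lsCountBelow L S γ ((y - lsCut L γ d) / lsWidth L γ d) (lsTail L S X d) := by
  unfold lsCountBelow
  rw [count_lsAdmissible_and hL]
  refine Finset.sum_congr rfl fun d hd => ?_
  congr 1
  funext m
  rw [lsPhi_lsPrepend hL hLS γ (Finset.mem_range.1 hd), lt_div_iff₀ (lsWidth_pos L hγ0 d),
    lt_sub_iff_add_lt', mul_comm]

theorem lsCount_eq_sum (hL : 1 ≤ L) (X : ℕ) :
    lsCount L S X = ∑ d ∈ Finset.range (L + S), lsCount L S (lsTail L S X d) := by
  classical
  have h : ∀ Y, lsCount L S Y = Nat.count (fun n => LSAdmissible L S n ∧ True) Y := by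
    intro Y
    unfold lsCount
    congr 1
    funext n
    exact propext (and_iff_left trivial).symm
  simp only [h]
  convert count_lsAdmissible_and (L := L) (S := S) hL (fun _ => True) X

theorem lsTail_le {X K d : ℕ} (h : X ≤ (L + S) ^ (K + 1)) :
    lsTail L S X d ≤ (L + S) ^ K := by
  have h1 : residueCount (L + S) X d ≤ (L + S) ^ K :=
    residueCount_le (by rwa [← pow_succ'])
  unfold lsTail
  split_ifs
  · exact h1
  · refine (residueCount_le ?_ : residueCount (L + S) (residueCount (L + S) X d) 0 ≤ (L + S) ^ K)
    rcases Nat.eq_zero_or_pos (L + S) with h0 | h0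
    · rw [h0] at h h1 ⊢
      simp [residueCount] at h ⊢
      omega
    · exact h1.trans (Nat.le_mul_of_pos_left _ h0)

/-- The counting function is `1`-Lipschitz, and `residueCount (L + S) X d` differs from
`X / (L + S)` by at most one. -/
theorem abs_lsCount_residueCount_sub_le (X d : ℕ) :
    |(lsCount L S (residueCount (L + S) X d) : ℝ) - lsCount L S (X / (L + S))| ≤ 1 := by
  have h1 := lsCount_mono (L := L) (S := S) (show X / (L + S) ≤ residueCount (L + S) X d from
    Nat.le_add_right _ _)
  have h2 : lsCount L S (residueCount (L + S) X d) ≤ lsCount L S (X / (L + S)) + 1 := by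
    refine (lsCount_mono ?_).trans (lsCount_succ_le _)
    unfold residueCount
    split_ifs <;> omega
  have h1' : (lsCount L S (X / (L + S)) : ℝ) ≤ lsCount L S (residueCount (L + S) X d) := by
    exact_mod_cast h1
  have h2' : (lsCount L S (residueCount (L + S) X d) : ℝ) ≤ lsCount L S (X / (L + S)) + 1 := by
    exact_mod_cast h2
  rw [abs_le]; constructor <;> linarith

/-- The partial geometric sum that bounds the deviation of the counting function from its
self-similar prediction; its ratio `S γ` is the modulus of the second root of `x² = L x + S`
(the first one being `1 / γ`). -/
noncomputable def lsGeom (S : ℕ) (γ : ℝ) (K : ℕ) : ℝ :=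
  ∑ j ∈ Finset.range (K + 1), ((S : ℝ) * γ) ^ j

theorem lsGeom_succ (S : ℕ) (γ : ℝ) (K : ℕ) :
    lsGeom S γ (K + 1) = S * γ * lsGeom S γ K + 1 := by
  unfold lsGeom
  rw [geom_sum_succ]

theorem lsGeom_mono (S : ℕ) {γ : ℝ} (hγ0 : 0 < γ) : Monotone (lsGeom S γ) :=
  monotone_nat_of_le_succ fun K => by
    unfold lsGeom
    rw [Finset.sum_range_succ _ (K + 1)]
    exact le_add_of_nonneg_right (by positivity)

theorem one_le_lsGeom (S : ℕ) {γ : ℝ} (hγ0 : 0 < γ) (K : ℕ) : 1 ≤ lsGeom S γ K :=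
  (by simp [lsGeom] : (1 : ℝ) = lsGeom S γ 0).le.trans (lsGeom_mono S hγ0 (Nat.zero_le K))

/-- The number of admissible numbers satisfies the recursion `t_{k+2} = L t_{k+1} + S t_k` up to a
bounded error. -/
theorem abs_lsCount_sub_le (hL : 1 ≤ L) (X : ℕ) :
    |(lsCount L S X : ℝ) - (L * lsCount L S (X / (L + S)) +
      S * lsCount L S (X / (L + S) / (L + S)))| ≤ 2 * (L + S) := by
  have hB : 0 < L + S := by omega
  rw [lsCount_eq_sum hL, Finset.sum_range_add]
  have h1 : ∀ d ∈ Finset.range L, |(lsCount L S (lsTail L S X d) : ℝ) -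
      lsCount L S (X / (L + S))| ≤ 2 := by
    intro d hd
    rw [lsTail, if_pos (Finset.mem_range.1 hd)]
    exact (abs_lsCount_residueCount_sub_le X d).trans (by norm_num)
  have h2 : ∀ d ∈ Finset.range S, |(lsCount L S (lsTail L S X (L + d)) : ℝ) -
      lsCount L S (X / (L + S) / (L + S))| ≤ 2 := by
    intro d _
    rw [lsTail, if_neg (by omega)]
    have h3 := abs_lsCount_residueCount_sub_le (L := L) (S := S)
      (residueCount (L + S) X (L + d)) 0
    have h4 : lsCount L S (X / (L + S) / (L + S)) ≤
        lsCount L S (residueCount (L + S) X (L + d) / (L + S)) :=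
      lsCount_mono (Nat.div_le_div_right (Nat.le_add_right _ _))
    have h5 : lsCount L S (residueCount (L + S) X (L + d) / (L + S)) ≤
        lsCount L S (X / (L + S) / (L + S)) + 1 := by
      refine (lsCount_mono ?_).trans (lsCount_succ_le _)
      rw [← Nat.add_div_right _ hB]
      refine Nat.div_le_div_right ?_
      unfold residueCount
      split_ifs <;> omega
    have h4' : (lsCount L S (X / (L + S) / (L + S)) : ℝ) ≤
        lsCount L S (residueCount (L + S) X (L + d) / (L + S)) := by exact_mod_cast h4
    have h5' : (lsCount L S (residueCount (L + S) X (L + d) / (L + S)) : ℝ) ≤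
        lsCount L S (X / (L + S) / (L + S)) + 1 := by exact_mod_cast h5
    rw [abs_le] at h3 ⊢
    constructor <;> linarith
  have e1 := (Finset.abs_sum_le_sum_abs _ _).trans (Finset.sum_le_sum h1)
  have e2 := (Finset.abs_sum_le_sum_abs _ _).trans (Finset.sum_le_sum h2)
  simp only [Finset.sum_sub_distrib, Finset.sum_const, Finset.card_range, nsmul_eq_mul] at e1 e2
  push_cast
  rw [abs_le] at e1 e2 ⊢
  constructor <;> linarith

/-- Deleting the lowest digit multiplies the counting function by `γ`, up to an error that obeys a
linear recursion of ratio `-S γ`. -/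
theorem abs_lsCount_div_sub_le (hL : 1 ≤ L) (hLS : 2 ≤ L + S) (hγ0 : 0 < γ)
    (hγ : (L : ℝ) * γ + (S : ℝ) * γ ^ 2 = 1) (K : ℕ) :
    ∀ X ≤ (L + S) ^ K, |(lsCount L S (X / (L + S)) : ℝ) - γ * lsCount L S X| ≤
      2 * (L + S) * lsGeom S γ K := by
  have hγ1 := ls_gamma_lt_one hL hLS hγ
  have hc : (2 : ℝ) ≤ (L : ℝ) + S := by exact_mod_cast hLS
  induction K with
  | zero =>
    intro X hX
    rw [pow_zero] at hX
    have h0 : X / (L + S) = 0 := Nat.div_eq_of_lt (by omega)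
    have hA0 : lsCount L S 0 = 0 := by simp [lsCount]
    have h1 : lsCount L S X ≤ 1 :=
      (lsCount_mono hX).trans ((lsCount_succ_le 0).trans (by rw [hA0]))
    have h1' : (lsCount L S X : ℝ) ≤ 1 := by exact_mod_cast h1
    have h2 : (0 : ℝ) ≤ lsCount L S X := Nat.cast_nonneg _
    have hg : lsGeom S γ 0 = 1 := by simp [lsGeom]
    rw [h0, hA0, hg, abs_le, Nat.cast_zero]
    constructor <;> nlinarith
  | succ K ih =>
    intro X hX
    have h1 := ih (X / (L + S)) (Nat.div_le_of_le_mul (by rwa [← pow_succ']))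
    have h2 := abs_lsCount_sub_le (S := S) hL X
    rw [lsGeom_succ]
    generalize (lsCount L S X : ℝ) = a at *
    generalize (lsCount L S (X / (L + S)) : ℝ) = b at *
    generalize (lsCount L S (X / (L + S) / (L + S)) : ℝ) = c at *
    have key : b - γ * a = -(S * γ) * (c - γ * b) - γ * (a - (L * b + S * c)) := by
      linear_combination (-b) * hγ
    have hθ : (0 : ℝ) ≤ S * γ := by positivity
    calc |b - γ * a| ≤ |-(S * γ) * (c - γ * b)| + |γ * (a - (L * b + S * c))| := by
          rw [key]; exact abs_sub _ _
      _ = S * γ * |c - γ * b| + γ * |a - (L * b + S * c)| := by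
          rw [abs_mul, abs_mul, abs_neg, abs_of_nonneg hθ, abs_of_pos hγ0]
      _ ≤ S * γ * (2 * (L + S) * lsGeom S γ K) + 1 * (2 * (L + S)) := by
          gcongr
      _ = _ := by ring

theorem abs_lsCount_lsTail_sub_le (hL : 1 ≤ L) (hLS : 2 ≤ L + S) (hγ0 : 0 < γ)
    (hγ : (L : ℝ) * γ + (S : ℝ) * γ ^ 2 = 1) {K X : ℕ} (hX : X ≤ (L + S) ^ (K + 1)) (d : ℕ) :
    |(lsCount L S (lsTail L S X d) : ℝ) - lsWidth L γ d * lsCount L S X| ≤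
      2 + 4 * (L + S) * lsGeom S γ (K + 1) := by
  have hγ1 := ls_gamma_lt_one hL hLS hγ
  have hR : residueCount (L + S) X d ≤ (L + S) ^ K := residueCount_le (by rwa [← pow_succ'])
  have h1 := abs_lsCount_residueCount_sub_le (L := L) (S := S) X d
  have h2 := abs_lsCount_div_sub_le hL hLS hγ0 hγ _ X hX
  have hg0 := one_le_lsGeom S hγ0 (K + 1)
  set D : ℝ := 2 * (L + S) * lsGeom S γ (K + 1) with hD
  have hD4 : 2 + 4 * (L + S) * lsGeom S γ (K + 1) = 2 + 2 * D := by rw [hD]; ring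
  have hD0 : 0 ≤ D := by positivity
  have h3 : |(lsCount L S (residueCount (L + S) X d) : ℝ) - γ * lsCount L S X| ≤ 1 + D := by
    rw [abs_le] at h1 h2 ⊢; constructor <;> linarith
  rw [hD4]
  unfold lsTail lsWidth
  split_ifs
  · linarith
  · have h4 := abs_lsCount_residueCount_sub_le (L := L) (S := S) (residueCount (L + S) X d) 0
    have h5 := (abs_lsCount_div_sub_le hL hLS hγ0 hγ _ _ hR).trans
      (mul_le_mul_of_nonneg_left (lsGeom_mono S hγ0 (Nat.le_succ K)) (by positivity))
    change _ ≤ D at h5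
    generalize (lsCount L S X : ℝ) = a at *
    have h6 : |γ * (lsCount L S (residueCount (L + S) X d) - γ * a)| ≤ 1 + D := by
      rw [abs_mul, abs_of_pos hγ0]
      exact (mul_le_of_le_one_left (abs_nonneg _) hγ1.le).trans h3
    rw [abs_le] at h4 h5 h6 ⊢
    constructor <;> nlinarith

/-! ### Local discrepancy -/

/-- Both sides are the length of the part of `[a, a + w)` below `y`. -/
theorem mul_clamp_div_eq {y a w : ℝ} (hw : 0 < w) :
    w * max 0 (min 1 ((y - a) / w)) = min y (a + w) - min y a := by
  have hz : w * ((y - a) / w) = y - a := mul_div_cancel₀ _ hw.ne'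
  rcases le_total y a with h | h
  · have h1 : (y - a) / w ≤ 0 := div_nonpos_of_nonpos_of_nonneg (by linarith) hw.le
    rw [max_eq_left ((min_le_right _ _).trans h1), min_eq_left h, min_eq_left (by linarith)]
    ring
  · have h0 : 0 ≤ (y - a) / w := div_nonneg (by linarith) hw.le
    rw [min_eq_right h]
    rcases le_total y (a + w) with h' | h'
    · have h1 : (y - a) / w ≤ 1 := (div_le_one hw).2 (by linarith)
      rw [min_eq_right h1, max_eq_right h0, min_eq_left h', hz]
    · have h1 : 1 ≤ (y - a) / w := (one_le_div hw).2 (by linarith)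
      rw [min_eq_left h1, max_eq_right zero_le_one, min_eq_right h']
      ring

theorem sum_lsWidth_mul_clamp (hL : 1 ≤ L) (hγ0 : 0 < γ)
    (hγ : (L : ℝ) * γ + (S : ℝ) * γ ^ 2 = 1) {y : ℝ} (hy : y ∈ Set.Icc (0 : ℝ) 1) :
    ∑ d ∈ Finset.range (L + S),
      lsWidth L γ d * max 0 (min 1 ((y - lsCut L γ d) / lsWidth L γ d)) = y := by
  have h : ∀ d ∈ Finset.range (L + S),
      lsWidth L γ d * max 0 (min 1 ((y - lsCut L γ d) / lsWidth L γ d)) =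
        min y (lsCut L γ (d + 1)) - min y (lsCut L γ d) := fun d _ => by
    rw [lsCut_succ, mul_clamp_div_eq (lsWidth_pos L hγ0 d)]
  rw [Finset.sum_congr rfl h, Finset.sum_range_sub (fun d => min y (lsCut L γ d)),
    lsCut_last hγ, lsCut_zero hL, min_eq_left hy.2, min_eq_right hy.1, sub_zero]

/-- At most one interval of the first partition contains `y` in its interior. -/
theorem lsCut_interior_unique (hγ0 : 0 < γ) {y : ℝ} {d e : ℕ}
    (hd : 0 < (y - lsCut L γ d) / lsWidth L γ d ∧ (y - lsCut L γ d) / lsWidth L γ d < 1)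
    (he : 0 < (y - lsCut L γ e) / lsWidth L γ e ∧ (y - lsCut L γ e) / lsWidth L γ e < 1) :
    d = e := by
  have key : ∀ i, 0 < (y - lsCut L γ i) / lsWidth L γ i ∧
      (y - lsCut L γ i) / lsWidth L γ i < 1 → lsCut L γ i < y ∧ y < lsCut L γ (i + 1) := by
    rintro i ⟨h1, h2⟩
    have hw := lsWidth_pos L hγ0 i
    rw [div_lt_one hw] at h2
    rw [lt_div_iff₀ hw] at h1
    rw [lsCut_succ]
    constructor <;> linarith
  obtain ⟨d1, d2⟩ := key d hd
  obtain ⟨e1, e2⟩ := key e he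
  rcases lt_trichotomy d e with h | h | h
  · have := lsCut_mono L hγ0 (show d + 1 ≤ e from h)
    linarith
  · exact h
  · have := lsCut_mono L hγ0 (show e + 1 ≤ d from h)
    linarith

theorem lsCountBelow_le (y : ℝ) (X : ℕ) : lsCountBelow L S γ y X ≤ lsCount L S X := by
  classical
  exact Nat.count_mono_left fun _ _ h => h.1

/-- Local discrepancy of the points of the admissible numbers below `X`. Passing to the interval of
the first partition that contains `y` costs one term of the size of the error in the counting
function. -/
theorem abs_lsCountBelow_sub_le (hL : 1 ≤ L) (hLS : 2 ≤ L + S) (hγ0 : 0 < γ)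
    (hγ : (L : ℝ) * γ + (S : ℝ) * γ ^ 2 = 1) (K : ℕ) :
    ∀ X ≤ (L + S) ^ K, ∀ y ∈ Set.Icc (0 : ℝ) 1,
      |(lsCountBelow L S γ y X : ℝ) - y * lsCount L S X| ≤
        (K + 1) * ((L + S) * (2 + 4 * (L + S) * lsGeom S γ K)) := by
  have hc : (2 : ℝ) ≤ (L : ℝ) + S := by exact_mod_cast hLS
  induction K with
  | zero =>
    rintro X hX y ⟨hy0, hy1⟩
    have hg := one_le_lsGeom S hγ0 0
    rw [pow_zero] at hX
    have h1 : lsCount L S X ≤ 1 :=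
      (lsCount_mono hX).trans ((lsCount_succ_le 0).trans (by simp [lsCount]))
    have h1' : (lsCount L S X : ℝ) ≤ 1 := by exact_mod_cast h1
    have h2 : (lsCountBelow L S γ y X : ℝ) ≤ lsCount L S X := by
      exact_mod_cast lsCountBelow_le y X
    have h3 : (0 : ℝ) ≤ lsCountBelow L S γ y X := Nat.cast_nonneg _
    have h4 : (1 : ℝ) ≤ ((0 : ℕ) + 1) * ((L + S) * (2 + 4 * (L + S) * lsGeom S γ 0)) := by
      have : 0 ≤ 4 * (L + S) * lsGeom S γ 0 := by positivity
      push_cast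
      nlinarith
    refine le_trans ?_ h4
    rw [abs_le]
    constructor <;> nlinarith
  | succ K ih =>
    intro X hX y hy
    set c : ℕ → ℝ := fun d => max 0 (min 1 ((y - lsCut L γ d) / lsWidth L γ d)) with hcdef
    set G : ℕ → ℝ := fun d =>
      lsCountBelow L S γ ((y - lsCut L γ d) / lsWidth L γ d) (lsTail L S X d) with hG
    set A : ℕ → ℝ := fun d => lsCount L S (lsTail L S X d) with hA
    set W : ℝ := (L + S) * (2 + 4 * (L + S) * lsGeom S γ (K + 1)) with hW
    have hc0 : ∀ d, 0 ≤ c d := fun d => le_max_left _ _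
    have hc1 : ∀ d, c d ≤ 1 := fun d => max_le zero_le_one (min_le_left _ _)
    have hgK := one_le_lsGeom S hγ0 K
    have hWK : (L + S) * (2 + 4 * (L + S) * lsGeom S γ K) ≤ W := by
      have := lsGeom_mono S hγ0 (Nat.le_succ K)
      rw [hW]
      gcongr
    have hG0 : ∀ d, (y - lsCut L γ d) / lsWidth L γ d ≤ 0 → G d - c d * A d = 0 := by
      intro d hd
      have h1 : c d = 0 := max_eq_left ((min_le_right _ _).trans hd)
      simp only [hG, h1, lsCountBelow_of_nonpos hL hLS hγ0 hγ hd, Nat.cast_zero, zero_mul,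
        sub_zero]
    have hG1 : ∀ d, 1 ≤ (y - lsCut L γ d) / lsWidth L γ d → G d - c d * A d = 0 := by
      intro d hd
      have h1 : c d = 1 := by simp only [hcdef, min_eq_left hd, max_eq_right zero_le_one]
      simp only [hG, hA, h1, lsCountBelow_of_one_le hL hLS hγ0 hγ hd, one_mul, sub_self]
    have hGb : ∀ d, |G d - c d * A d| ≤ (K + 1) * W := fun d =>
      (le_trans (by
        by_cases h0 : (y - lsCut L γ d) / lsWidth L γ d ≤ 0
        · rw [hG0 d h0, abs_zero]; positivity
        by_cases h1 : 1 ≤ (y - lsCut L γ d) / lsWidth L γ d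
        · rw [hG1 d h1, abs_zero]; positivity
        push Not at h0 h1
        have h2 : c d = (y - lsCut L γ d) / lsWidth L γ d := by
          simp only [hcdef, min_eq_right h1.le, max_eq_right h0.le]
        rw [h2]
        exact ih _ (lsTail_le hX) _ ⟨h0.le, h1.le⟩)
        (mul_le_mul_of_nonneg_left hWK (by positivity)))
    have hfirst : |∑ d ∈ Finset.range (L + S), (G d - c d * A d)| ≤ (K + 1) * W := by
      by_cases hj : ∃ j ∈ Finset.range (L + S), G j - c j * A j ≠ 0
      · obtain ⟨j, hj, hne⟩ := hj
        have hint : ∀ i, G i - c i * A i ≠ 0 → 0 < (y - lsCut L γ i) / lsWidth L γ i ∧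
            (y - lsCut L γ i) / lsWidth L γ i < 1 := fun i hi =>
          ⟨not_le.1 fun h => hi (hG0 i h), not_le.1 fun h => hi (hG1 i h)⟩
        rw [Finset.sum_eq_single j]
        · exact hGb j
        · intro i _ hij
          by_contra hi
          exact hij (lsCut_interior_unique hγ0 (hint i hi) (hint j hne))
        · exact fun h => absurd hj h
      · push Not at hj
        rw [Finset.sum_eq_zero hj, abs_zero]
        have : 0 ≤ W := le_trans (by positivity) hWK
        positivity
    have hsecond : |∑ d ∈ Finset.range (L + S),
        c d * (A d - lsWidth L γ d * lsCount L S X)| ≤ W := by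
      refine (Finset.abs_sum_le_sum_abs _ _).trans ?_
      have : ∀ d ∈ Finset.range (L + S), |c d * (A d - lsWidth L γ d * lsCount L S X)| ≤
          2 + 4 * (L + S) * lsGeom S γ (K + 1) := fun d _ => by
        rw [abs_mul, abs_of_nonneg (hc0 d)]
        exact (mul_le_of_le_one_left (abs_nonneg _) (hc1 d)).trans
          (abs_lsCount_lsTail_sub_le hL hLS hγ0 hγ hX d)
      refine (Finset.sum_le_sum this).trans ?_
      rw [Finset.sum_const, Finset.card_range, nsmul_eq_mul, hW]
      push_cast
      rfl
    have hsplit : (lsCountBelow L S γ y X : ℝ) - y * lsCount L S X =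
        ∑ d ∈ Finset.range (L + S), (G d - c d * A d) +
          ∑ d ∈ Finset.range (L + S), c d * (A d - lsWidth L γ d * lsCount L S X) := by
      rw [← Finset.sum_add_distrib]
      have h1 : (lsCountBelow L S γ y X : ℝ) = ∑ d ∈ Finset.range (L + S), G d := by
        rw [lsCountBelow_eq_sum hL hLS hγ0]
        push_cast
        rfl
      have h2 : y * lsCount L S X =
          ∑ d ∈ Finset.range (L + S), lsWidth L γ d * c d * lsCount L S X := by
        rw [← Finset.sum_mul, sum_lsWidth_mul_clamp hL hγ0 hγ hy]
      rw [h1, h2, ← Finset.sum_sub_distrib]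
      exact Finset.sum_congr rfl fun d _ => by ring
    rw [hsplit]
    refine (abs_add_le _ _).trans ((add_le_add hfirst hsecond).trans_eq ?_)
    push_cast
    ring

/-! ### Growth of the counting function and enumeration -/

theorem residueCount_pow_succ (B K d : ℕ) (hB : 0 < B) :
    residueCount B (B ^ (K + 1)) d = B ^ K := by
  rw [residueCount, pow_succ', Nat.mul_div_cancel_left _ hB, Nat.mul_mod_right, if_neg (by omega),
    add_zero]

theorem one_le_pow_mul_lsCount (hL : 1 ≤ L) (hLS : 2 ≤ L + S) (hγ0 : 0 < γ)
    (hγ : (L : ℝ) * γ + (S : ℝ) * γ ^ 2 = 1) (K : ℕ) :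
    1 ≤ γ ^ K * lsCount L S ((L + S) ^ K) := by
  have hB : 0 < L + S := by omega
  have hγ1 := ls_gamma_lt_one hL hLS hγ
  have h1 : lsCount L S 1 = 1 := by
    unfold lsCount
    rw [Nat.count_one, if_pos (lsAdmissible_zero L S)]
  induction K using Nat.twoStepInduction with
  | zero => simp [h1]
  | one =>
    have h2 : lsCount L S ((L + S) ^ 1) = L + S := by
      rw [lsCount_eq_sum hL, Finset.sum_congr rfl (g := fun _ => 1), Finset.sum_const,
        Finset.card_range, smul_eq_mul, mul_one]
      intro d _
      have h3 : residueCount (L + S) 1 0 = 1 := by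
        rw [residueCount, Nat.div_eq_of_lt (by omega), Nat.mod_eq_of_lt (by omega)]
        simp
      have h5 := residueCount_pow_succ (L + S) 0 d hB
      rw [lsTail, h5, pow_zero, h3, ite_self, h1]
    rw [h2, pow_one]
    have h4 : (0 : ℝ) ≤ S := Nat.cast_nonneg S
    push_cast
    nlinarith [mul_nonneg h4 hγ0.le]
  | more K ih0 ih1 =>
    have h2 : lsCount L S ((L + S) ^ (K + 2)) =
        L * lsCount L S ((L + S) ^ (K + 1)) + S * lsCount L S ((L + S) ^ K) := by
      rw [lsCount_eq_sum hL, Finset.sum_range_add]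
      congr 1
      · rw [Finset.sum_congr rfl (g := fun _ => lsCount L S ((L + S) ^ (K + 1)))]
        · simp
        · intro d hd
          rw [lsTail, if_pos (Finset.mem_range.1 hd), residueCount_pow_succ _ _ _ hB]
      · rw [Finset.sum_congr rfl (g := fun _ => lsCount L S ((L + S) ^ K))]
        · simp
        · intro d _
          rw [lsTail, if_neg (by omega), residueCount_pow_succ _ _ _ hB,
            residueCount_pow_succ _ _ _ hB]
    rw [h2, ← hγ]
    push_cast
    calc (L : ℝ) * γ + S * γ ^ 2 = L * γ * 1 + S * γ ^ 2 * 1 := by ring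
      _ ≤ L * γ * (γ ^ (K + 1) * lsCount L S ((L + S) ^ (K + 1))) +
          S * γ ^ 2 * (γ ^ K * lsCount L S ((L + S) ^ K)) := by gcongr
      _ = _ := by ring

theorem lsAdmissible_infinite (hL : 1 ≤ L) (hLS : 2 ≤ L + S) :
    (Set.ofPred (LSAdmissible L S)).Infinite := by
  refine Set.infinite_of_forall_exists_gt fun a => ⟨(L + S) ^ a, ?_, Nat.lt_pow_self (by omega)⟩
  induction a with
  | zero =>
    have := lsAdmissible_add_mul (L := L) (S := S) (d := 1) (by omega) 0
    exact this.2 ⟨lsAdmissible_zero L S, fun _ => Nat.zero_mod _⟩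
  | succ a ih =>
    change LSAdmissible L S _
    rw [pow_succ', lsAdmissible_mul hL]
    exact ih

end Counting

/-- Counting along the increasing enumeration of an infinite set. -/
theorem count_comp_nth {p : ℕ → Prop} [DecidablePred p] (hp : (Set.ofPred p).Infinite)
    (Q : ℕ → Prop) [DecidablePred Q] (M : ℕ) :
    Nat.count (fun i => Q (Nat.nth p i)) M = Nat.count (fun n => p n ∧ Q n) (Nat.nth p M) := by
  induction M with
  | zero =>
    rw [Nat.count_zero, eq_comm, Nat.count_iff_forall_not]
    rintro m hm ⟨h, -⟩
    exact Nat.not_lt_zero _ ((Nat.count_strict_mono h hm).trans_eq (Nat.count_nth_zero p))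
  | succ M ih =>
    rw [Nat.count_succ, ih, Nat.count_eq_card_filter_range, Nat.count_eq_card_filter_range,
      ← Finset.filter_filter, ← Finset.filter_filter,
      Nat.filter_range_nth_eq_insert_of_infinite hp, Finset.filter_insert]
    split_ifs with h
    · rw [Finset.card_insert_of_notMem (by simp)]
    · rfl

/-! ### Discrepancy of the planar point sets -/

/-- For a sequence `x` in `[0, 1)`, a bound `E` for the local discrepancies of its initial segments
of length at most `N` bounds the discrepancy of the planar point set `{(i / N, x i) : i < N}`. -/
theorem mul_squareDiscrepancy_le {x : ℕ → ℝ} {N : ℕ} (hN : 0 < N) {E : ℝ}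
    (hE : ∀ M ≤ N, ∀ y ∈ Set.Icc (0 : ℝ) 1,
      |∑ i ∈ Finset.range M, (if x i < y then (1 : ℝ) else 0) - y * M| ≤ E)
    {P : Finset (ℝ × ℝ)}
    (hP : P = open scoped Classical in
      (Finset.range N).image fun i : ℕ => ((i : ℝ) / (N : ℝ), x i)) :
    (N : ℝ) * squareDiscrepancy P ≤ 4 * E + 1 := by
  classical
  have hN' : (0 : ℝ) < N := by exact_mod_cast hN
  have hinj : Function.Injective fun i : ℕ => ((i : ℝ) / (N : ℝ), x i) := by
    intro i j hij
    have h := (Prod.ext_iff.1 hij).1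
    exact_mod_cast (div_left_inj' hN'.ne').1 h
  have hE0 : 0 ≤ E := (abs_nonneg _).trans (hE 0 (Nat.zero_le _) 0 ⟨le_rfl, zero_le_one⟩)
  have hcard : P.card = N := by
    rw [hP]
    convert Finset.card_image_of_injective (Finset.range N) hinj using 1
    simp
  suffices h : squareDiscrepancy P ≤ (4 * E + 1) / N by
    rw [le_div_iff₀ hN'] at h
    linarith
  refine Real.sSup_le ?_ (by positivity)
  rintro _ ⟨a₁, b₁, a₂, b₂, ha₁, hab₁, hb₁, ha₂, hab₂, hb₂, rfl⟩
  set u := ⌈a₁ * N⌉₊ with hu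
  set v := ⌈b₁ * N⌉₊ with hv
  have huv : u ≤ v := Nat.ceil_mono (by gcongr)
  have hvN : v ≤ N := Nat.ceil_le.2 (by nlinarith)
  have hcount : ((P.filter fun p => p ∈ Set.Ico a₁ b₁ ×ˢ Set.Ico a₂ b₂).card : ℝ) =
      ∑ i ∈ Finset.Ico u v,
        ((if x i < b₂ then (1 : ℝ) else 0) - (if x i < a₂ then 1 else 0)) := by
    have h1 : (P.filter fun p => p ∈ Set.Ico a₁ b₁ ×ˢ Set.Ico a₂ b₂) =
        ((Finset.Ico u v).filter fun i => a₂ ≤ x i ∧ x i < b₂).image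
          fun i : ℕ => ((i : ℝ) / (N : ℝ), x i) := by
      ext p
      simp only [hP, Finset.mem_filter, Finset.mem_image, Finset.mem_range, Set.mem_prod,
        Set.mem_Ico, Finset.mem_Ico]
      constructor
      · rintro ⟨⟨i, hi, rfl⟩, ⟨h2, h3⟩, h4⟩
        refine ⟨i, ⟨⟨?_, ?_⟩, h4⟩, rfl⟩
        · exact Nat.ceil_le.2 ((le_div_iff₀ hN').1 h2)
        · exact Nat.lt_ceil.2 ((div_lt_iff₀ hN').1 h3)
      · rintro ⟨i, ⟨⟨h2, h3⟩, h4⟩, rfl⟩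
        exact ⟨⟨i, h3.trans_le hvN, rfl⟩, ⟨(le_div_iff₀ hN').2 (Nat.ceil_le.1 h2),
          (div_lt_iff₀ hN').2 (Nat.lt_ceil.1 h3)⟩, h4⟩
    rw [h1, Finset.card_image_of_injective _ hinj, Finset.card_filter, Nat.cast_sum]
    refine Finset.sum_congr rfl fun i _ => ?_
    by_cases h2 : x i < a₂
    · simp [h2, h2.trans hab₂, not_le.2 h2]
    · simp [h2, not_lt.1 h2]
  rw [Finset.sum_Ico_eq_sub _ huv, Finset.sum_sub_distrib, Finset.sum_sub_distrib] at hcount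
  have hb : b₂ ∈ Set.Icc (0 : ℝ) 1 := ⟨by linarith, hb₂⟩
  have ha : a₂ ∈ Set.Icc (0 : ℝ) 1 := ⟨ha₂, by linarith⟩
  have e1 := abs_le.1 (hE v hvN b₂ hb)
  have e2 := abs_le.1 (hE v hvN a₂ ha)
  have e3 := abs_le.1 (hE u (huv.trans hvN) b₂ hb)
  have e4 := abs_le.1 (hE u (huv.trans hvN) a₂ ha)
  have u1 : a₁ * N ≤ u := Nat.le_ceil _
  have u2 : (u : ℝ) < a₁ * N + 1 := Nat.ceil_lt_add_one (by positivity)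
  have v1 : b₁ * N ≤ v := Nat.le_ceil _
  have v2 : (v : ℝ) < b₁ * N + 1 := Nat.ceil_lt_add_one (by nlinarith)
  -- Rounding the first coordinates to multiples of `1 / N` changes the area by at most `1 / N`.
  have hround : |((v : ℝ) - u - (b₁ - a₁) * N) * (b₂ - a₂)| ≤ 1 := by
    rw [abs_mul]
    refine mul_le_one₀ ?_ (abs_nonneg _) ?_
    · rw [abs_le]; constructor <;> linarith
    · rw [abs_le]; constructor <;> linarith
  rw [hcard, le_div_iff₀ hN', ← abs_of_pos hN', ← abs_mul, abs_of_pos hN', sub_mul,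
    div_mul_cancel₀ _ hN'.ne', hcount]
  rw [abs_le] at hround ⊢
  constructor <;> nlinarith

section Enumeration

variable {L S : ℕ} {γ : ℝ}

theorem lsPointSet_eq_image_range (N : ℕ) :
    lsPointSet L S γ N = open scoped Classical in
      (Finset.range N).image fun i : ℕ => ((i : ℝ) / (N : ℝ), lsPoint L S γ (i + 1)) := by
  classical
  unfold lsPointSet
  ext p
  simp only [Finset.mem_image, Finset.mem_Icc, Finset.mem_range]
  constructor
  · rintro ⟨n, ⟨h1, h2⟩, rfl⟩
    exact ⟨n - 1, by omega, by rw [Nat.sub_add_cancel h1]; push_cast [h1]; rfl⟩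
  · rintro ⟨i, hi, rfl⟩
    exact ⟨i + 1, ⟨by omega, by omega⟩, by push_cast; rw [add_sub_cancel_right]⟩

/-- Local discrepancy of the initial segments of the `LS`-sequence. -/
theorem abs_sum_lsPoint_sub_le (hL : 1 ≤ L) (hLS : 2 ≤ L + S) (hγ0 : 0 < γ)
    (hγ : (L : ℝ) * γ + (S : ℝ) * γ ^ 2 = 1) {K M : ℕ} (hM : (M : ℝ) * γ ^ K < 1)
    {y : ℝ} (hy : y ∈ Set.Icc (0 : ℝ) 1) :
    |∑ i ∈ Finset.range M, (if lsPoint L S γ (i + 1) < y then (1 : ℝ) else 0) - y * M| ≤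
      (K + 1) * ((L + S) * (2 + 4 * (L + S) * lsGeom S γ K)) := by
  classical
  have hinf := lsAdmissible_infinite hL hLS
  have hlt : M < lsCount L S ((L + S) ^ K) := by
    have h1 := one_le_pow_mul_lsCount hL hLS hγ0 hγ K
    have h2 : (M : ℝ) < lsCount L S ((L + S) ^ K) := by
      by_contra! h
      have : γ ^ K * lsCount L S ((L + S) ^ K) ≤ γ ^ K * M := by gcongr
      linarith
    exact_mod_cast h2
  have hX : Nat.nth (LSAdmissible L S) M ≤ (L + S) ^ K :=
    (Nat.nth_lt_of_lt_count (p := LSAdmissible L S) (by unfold lsCount at hlt; convert hlt)).le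
  have h1 := abs_lsCountBelow_sub_le hL hLS hγ0 hγ K _ hX y hy
  have h2 : lsCount L S (Nat.nth (LSAdmissible L S) M) = M := by
    unfold lsCount
    convert Nat.count_nth_of_infinite hinf M
  have h3 := count_comp_nth hinf (fun n => lsPhi L S γ n < y) M
  have h4 : ∑ i ∈ Finset.range M, (if lsPoint L S γ (i + 1) < y then (1 : ℝ) else 0) =
      lsCountBelow L S γ y (Nat.nth (LSAdmissible L S) M) := by
    have h5 : lsCountBelow L S γ y (Nat.nth (LSAdmissible L S) M) =
        Nat.count (fun n => LSAdmissible L S n ∧ lsPhi L S γ n < y)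
          (Nat.nth (LSAdmissible L S) M) := by
      unfold lsCountBelow
      congr
    rw [h5, ← h3, Nat.count_eq_card_filter_range, Finset.card_filter, Nat.cast_sum]
    refine Finset.sum_congr rfl fun i _ => ?_
    simp [lsPoint]
  rw [h4]
  rw [h2] at h1
  exact h1

/-- The discrepancy bound in terms of the partial geometric sum of ratio `S γ`, up to the level `K`
at which the intervals of the partition become shorter than `1 / N`. -/
theorem mul_squareDiscrepancy_lsPointSet_le (hL : 1 ≤ L) (hLS : 2 ≤ L + S) (hγ0 : 0 < γ)
    (hγ : (L : ℝ) * γ + (S : ℝ) * γ ^ 2 = 1) :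
    ∃ C : ℝ, 0 < C ∧ ∀ N : ℕ, 2 ≤ N → ∃ K : ℕ, (K : ℝ) ≤ Real.log N / (-Real.log γ) + 1 ∧
      (K : ℝ) + 1 ≤ C * Real.log N ∧
      (N : ℝ) * squareDiscrepancy (lsPointSet L S γ N) ≤ C * (Real.log N * lsGeom S γ K) := by
  have hγ1 := ls_gamma_lt_one hL hLS hγ
  set b := -Real.log γ with hb
  have hb0 : 0 < b := neg_pos.2 (Real.log_neg hγ0 hγ1)
  have hl2 : 0 < Real.log 2 := Real.log_pos one_lt_two
  set c : ℝ := 1 / b + 2 / Real.log 2 with hc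
  have hc0 : 0 < c := by positivity
  have hB : (2 : ℝ) ≤ (L : ℝ) + S := by exact_mod_cast hLS
  set D : ℝ := 4 * ((L + S) * (2 + 4 * (L + S))) + 1 with hD
  have hD1 : 1 ≤ D := by
    have : (0 : ℝ) ≤ 4 * ((L + S) * (2 + 4 * (L + S))) := by positivity
    linarith
  refine ⟨c * D, by positivity, fun N hN => ?_⟩
  have hN2 : (2 : ℝ) ≤ N := by exact_mod_cast hN
  have hlogN : Real.log 2 ≤ Real.log N := Real.log_le_log two_pos hN2
  have hlog0 : 0 < Real.log N := hl2.trans_le hlogN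
  set K : ℕ := ⌊Real.log N / b⌋₊ + 1 with hK
  have hK1 : (K : ℝ) ≤ Real.log N / b + 1 := by
    rw [hK]
    push_cast
    have := Nat.floor_le (div_nonneg hlog0.le hb0.le)
    linarith
  have hK2 : Real.log N < K * b := by
    rw [hK]
    push_cast
    exact (div_lt_iff₀ hb0).1 (Nat.lt_floor_add_one _)
  have hK3 : (K : ℝ) + 1 ≤ c * Real.log N := by
    have h1 : 2 ≤ 2 / Real.log 2 * Real.log N := by
      rw [div_mul_eq_mul_div, le_div_iff₀ hl2]
      gcongr
    have h2 : c * Real.log N = Real.log N / b + 2 / Real.log 2 * Real.log N := by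
      rw [hc]; ring
    linarith
  have hNK : (N : ℝ) * γ ^ K < 1 := by
    have h0 : 0 < (N : ℝ) * γ ^ K := by positivity
    rw [← Real.log_neg_iff h0, Real.log_mul (by positivity) (by positivity), Real.log_pow]
    have : (K : ℝ) * Real.log γ = -(K * b) := by rw [hb]; ring
    linarith
  have hg := one_le_lsGeom S hγ0 K
  refine ⟨K, hK1, hK3.trans ?_, ?_⟩
  · have : c * Real.log N * 1 ≤ c * Real.log N * D := by gcongr
    linarith
  · refine (mul_squareDiscrepancy_le (x := fun i => lsPoint L S γ (i + 1)) (by omega)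
      (fun M hM y hy => abs_sum_lsPoint_sub_le hL hLS hγ0 hγ (K := K) ?_ hy)
      (lsPointSet_eq_image_range N)).trans ?_
    · refine lt_of_le_of_lt ?_ hNK
      gcongr
    · have hK0 : (0 : ℝ) ≤ K := Nat.cast_nonneg K
      calc 4 * ((K + 1) * ((L + S) * (2 + 4 * (L + S) * lsGeom S γ K))) + 1
          ≤ 4 * ((K + 1) * ((L + S) * (2 * lsGeom S γ K + 4 * (L + S) * lsGeom S γ K))) +
            (K + 1) * lsGeom S γ K := by
            have h1 : (1 : ℝ) ≤ (K + 1) * lsGeom S γ K := by nlinarith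
            have h2 : (2 : ℝ) ≤ 2 * lsGeom S γ K := by linarith
            gcongr
        _ = (K + 1) * (D * lsGeom S γ K) := by rw [hD]; ring
        _ ≤ c * Real.log N * (D * lsGeom S γ K) := by gcongr
        _ = c * D * (Real.log N * lsGeom S γ K) := by ring

end Enumeration

theorem proposition5 (L S : ℕ) (hL : 1 ≤ L) (hLS : 2 ≤ L + S)
    (γ : ℝ) (hγ_pos : 0 < γ) (hγ : (L : ℝ) * γ + (S : ℝ) * γ ^ 2 = 1) :
    (S ≤ L → ∃ C₁ : ℝ, 0 < C₁ ∧ ∀ N : ℕ, 2 ≤ N →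
      (N : ℝ) * squareDiscrepancy (lsPointSet L S γ N) ≤ C₁ * Real.log N) ∧
    (S = L + 1 → ∃ C₂ : ℝ, 0 < C₂ ∧ ∀ N : ℕ, 2 ≤ N →
      (N : ℝ) * squareDiscrepancy (lsPointSet L S γ N) ≤ C₂ * Real.log N ^ 2) ∧
    (L + 2 ≤ S → ∀ τ : ℝ, 1 - τ = -(Real.log ((S : ℝ) * γ) / Real.log γ) →
      0 < 1 - τ ∧ ∃ C₃ : ℝ, 0 < C₃ ∧ ∀ N : ℕ, 2 ≤ N →
        (N : ℝ) * squareDiscrepancy (lsPointSet L S γ N)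
          ≤ C₃ * ((N : ℝ) ^ (1 - τ) * Real.log N)) := by
  have hγ1 := ls_gamma_lt_one hL hLS hγ
  have hL1 : (1 : ℝ) ≤ L := by exact_mod_cast hL
  have hS0 : (0 : ℝ) ≤ S := Nat.cast_nonneg S
  have hlogpos : ∀ N : ℕ, 2 ≤ N → 0 < Real.log N := fun N hN =>
    Real.log_pos (by exact_mod_cast hN)
  obtain ⟨C, hC, hmain⟩ := mul_squareDiscrepancy_lsPointSet_le hL hLS hγ_pos hγ
  set θ : ℝ := S * γ with hθ
  have hθ0 : 0 ≤ θ := by positivity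
  -- The equation for `γ` compares `S γ` with `1` according to the sign of `S - (L + 1)`.
  have hfac : (θ - 1) * (1 + γ) = ((S : ℝ) - (L + 1)) * γ := by
    rw [hθ]; linear_combination hγ
  refine ⟨fun hSL => ?_, fun hSL => ?_, fun hSL τ hτ => ?_⟩
  · have hSL' : (S : ℝ) ≤ L := by exact_mod_cast hSL
    have hθ1 : θ < 1 := by nlinarith
    have hθ1' : 0 < 1 - θ := by linarith
    refine ⟨C * (1 - θ)⁻¹, by positivity, fun N hN => ?_⟩
    obtain ⟨K, -, -, h⟩ := hmain N hN
    have hg : lsGeom S γ K ≤ (1 - θ)⁻¹ := by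
      rw [lsGeom, ← tsum_geometric_of_lt_one hθ0 hθ1]
      exact (summable_geometric_of_lt_one hθ0 hθ1).sum_le_tsum _ fun _ _ => by positivity
    have := hlogpos N hN
    calc _ ≤ C * (Real.log N * lsGeom S γ K) := h
      _ ≤ C * (Real.log N * (1 - θ)⁻¹) := by gcongr
      _ = _ := by ring
  · have hSL' : (S : ℝ) = L + 1 := by exact_mod_cast hSL
    have hθ1 : θ = 1 := by
      rw [hSL', sub_self, zero_mul] at hfac
      have := (mul_eq_zero.1 hfac).resolve_right (by linarith)
      linarith
    refine ⟨C * C, by positivity, fun N hN => ?_⟩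
    obtain ⟨K, -, hK, h⟩ := hmain N hN
    have hg : lsGeom S γ K ≤ C * Real.log N := by
      rw [lsGeom, ← hθ, hθ1]
      simpa using hK
    have := hlogpos N hN
    calc _ ≤ C * (Real.log N * lsGeom S γ K) := h
      _ ≤ C * (Real.log N * (C * Real.log N)) := by gcongr
      _ = _ := by ring
  · have hSL' : (L : ℝ) + 2 ≤ S := by exact_mod_cast hSL
    have hθ1 : 1 < θ := by nlinarith
    have hlogγ : Real.log γ < 0 := Real.log_neg hγ_pos hγ1
    have hτ' : 1 - τ = Real.log θ / (-Real.log γ) := by rw [hτ, div_neg]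
    refine ⟨by rw [hτ']; exact div_pos (Real.log_pos hθ1) (by linarith), ?_⟩
    have hθ1' : 0 < θ - 1 := by linarith
    refine ⟨C * (θ ^ 2 / (θ - 1)), by positivity, fun N hN => ?_⟩
    obtain ⟨K, hK, -, h⟩ := hmain N hN
    have hN0 : (0 : ℝ) < N := by exact_mod_cast (by omega : 0 < N)
    -- `θ ^ (log N / log (1 / γ)) = N ^ (1 - τ)`
    have hpow : θ ^ K ≤ θ * (N : ℝ) ^ (1 - τ) := by
      rw [← Real.rpow_natCast]
      refine (Real.rpow_le_rpow_of_exponent_le hθ1.le hK).trans_eq ?_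
      rw [Real.rpow_add (by linarith), Real.rpow_one, mul_comm, hτ',
        Real.rpow_def_of_pos (by linarith), Real.rpow_def_of_pos hN0]
      congr 2
      ring
    have hg : lsGeom S γ K ≤ θ ^ 2 / (θ - 1) * (N : ℝ) ^ (1 - τ) := by
      rw [lsGeom, geom_sum_eq hθ1.ne', div_mul_eq_mul_div]
      gcongr
      rw [pow_succ]
      nlinarith
    have := hlogpos N hN
    calc _ ≤ C * (Real.log N * lsGeom S γ K) := h
      _ ≤ C * (Real.log N * (θ ^ 2 / (θ - 1) * (N : ℝ) ^ (1 - τ))) := by gcongr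
      _ = _ := by ring
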